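/- Let $P=P^n\subset\mathbb R^n$ be a simple polytope with $m$ facets $F_1,\dots,F_m$, that is, a bounded intersection of finitely many closed half-spaces which has dimension $n$ and in which exactly $n$ facets meet at each vertex. Let $T^m=(S^1)^m$, and for $I\subset\{1,\dots,m\}$ let $T^I\subset T^m$ be the coordinate subgroup $\{t : t_j=1 \text{ for } j\notin I\}$. Put $$\mathcal Z_P=(T^m\times P)/{\sim},\qquad (g,p)\sim(h,q)\iff p=q \text{ and } g^{-1}h\in T^{I},$$ where $p$ lies in the relative interior of the face $\bigcap_{i\in I}F_i$ (so $I=\{i : p\in F_i\}$). Give $\mathcal Z_P$ the quotient topology and the $T^m$-action $s\cdot[t,x]=[st,x]$. Write $P=\{x\in\mathbb R^n : \ell_i(x)\ge 0,\ i=1,\dots,m\}$ with affine functions $\ell_i$ such that $F_i=P\cap\{\ell_i=0\}$. For a vertex $v$ of $P$ let $I_v=\{i : v\in F_i\}$ (so $|I_v|=n$), and let $U_v\subset\mathcal Z_P$ be the set of all $[t,x]$ such that $x$ lies on no facet $F_j$ with $j\notin I_v$. The block coordinates at $v$ are the map $$U_v\to\mathbb C^{n}\times T^{m-n},\qquad [t,x]\mapsto\Bigl(\bigl(t_i\sqrt{\ell_i(x)}\bigr)_{i\in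 I_v},\,(t_j)_{j\notin I_v}\Bigr).$$ **Theorem.** The space $\mathcal Z_P$ is Hausdorff and second countable, and it has a canonical structure of a smooth $(m+n)$-dimensional manifold without boundary: there is exactly one smooth structure on $\mathcal Z_P$ for which, for every choice of such functions $\ell_i$ and for every vertex $v$, the set $U_v$ is open and the block coordinates at $v$ are a diffeomorphism of $U_v$ onto an open subset of $\mathbb C^n\times T^{m-n}$. For this structure the action $T^m\times\mathcal Z_P\to\mathcal Z_P$ is smooth. Furthermore, there is a $T^m$-equivariant smooth embedding $i_e:\mathcal Z_P\to\mathbb C^m$ whose image lies in the polydisc $(D^2)^m=\{z\in\mathbb C^m : |z_i|\le 1\}$, where $T^m$ acts on $\mathbb C^m$ by coordinatewise multiplication. -/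

import Mathlib

open scoped Manifold ContDiff

/-- A simple polytope `P` of dimension `n` in `ℝⁿ` together with an enumeration
`F₁, …, F_m` of its facets. `P` is bounded, has dimension `n`, is cut out by one closed half-space
`0 ≤ ℓ i` for each facet `Fᵢ = P ∩ {ℓ i = 0}`, the facets are pairwise distinct and have
dimension `n - 1`, and exactly `n` of them meet at each vertex. The affine functions `ℓ i` are
determined by `P` up to positive factors and are not part of the data. -/
structure SimplePolytope (n m : ℕ) where
  carrier : Set (EuclideanSpace ℝ (Fin n))
  facet : Fin m → Set (EuclideanSpace ℝ (Fin n))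
  exists_halfspaces : ∃ ℓ : Fin m → (EuclideanSpace ℝ (Fin n) →ᵃ[ℝ] ℝ),
    carrier = {x | ∀ i, 0 ≤ ℓ i x} ∧ ∀ i, facet i = {x ∈ carrier | ℓ i x = 0}
  isBounded : Bornology.IsBounded carrier
  interior_nonempty : (interior carrier).Nonempty
  facet_nonempty : ∀ i, (facet i).Nonempty
  finrank_facet : ∀ i, Module.finrank ℝ (vectorSpan ℝ (facet i)) + 1 = n
  facet_injective : Function.Injective facet
  ncard_facets_vertex : ∀ v ∈ carrier.extremePoints ℝ, {i | v ∈ facet i}.ncard = n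

namespace SimplePolytope

variable {n m : ℕ} (P : SimplePolytope n m)

/-- `ℓ` is a system of affine inequalities, one for each facet, which defines `P`. -/
def IsDefiningSystem (ℓ : Fin m → (EuclideanSpace ℝ (Fin n) →ᵃ[ℝ] ℝ)) : Prop :=
  P.carrier = {x | ∀ i, 0 ≤ ℓ i x} ∧ ∀ i, P.facet i = {x ∈ P.carrier | ℓ i x = 0}

/-- The indices `i₁, …, i_k` of the facets that contain `p`. The point `p` lies in the relative
interior of exactly one face of `P`, and this face is `F_{i₁} ∩ ⋯ ∩ F_{i_k}` (all of `P` when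
there is no such facet). -/
def facetsThrough (p : EuclideanSpace ℝ (Fin n)) : Set (Fin m) := {i | p ∈ P.facet i}

end SimplePolytope

/-- The coordinate subgroup of the torus `T^m = (S¹)^m` which belongs to a set `S` of indices:
the elements whose coordinates outside `S` are `1`. -/
def coordinateSubgroup {m : ℕ} (S : Set (Fin m)) : Subgroup (Fin m → Circle) where
  carrier := {t | ∀ i ∉ S, t i = 1}
  one_mem' := fun _ _ => rfl
  mul_mem' := fun ha hb i hi => by simp [ha i hi, hb i hi]
  inv_mem' := fun ha i hi => by simp [ha i hi]

namespace SimplePolytope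

variable {n m : ℕ} (P : SimplePolytope n m)

/-- The equivalence relation on `T^m × P`: `(g, p) ∼ (h, q)` iff `p = q` and `g⁻¹ h` lies in the
coordinate subgroup of the face that has `p` in its relative interior. -/
def torusSetoid : Setoid ((Fin m → Circle) × P.carrier) where
  r a b := a.2 = b.2 ∧ a.1⁻¹ * b.1 ∈ coordinateSubgroup (P.facetsThrough a.2)
  iseqv :=
    { refl := fun a => ⟨rfl, by simp [one_mem]⟩
      symm := fun {a b} h => ⟨h.1.symm, by
        have := inv_mem h.2
        rw [← h.1]
        simpa using this⟩
      trans := fun {a b c} h k => ⟨h.1.trans k.1, by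
        have h2 := k.2
        rw [← h.1] at h2
        have := mul_mem h.2 h2
        simpa [mul_assoc] using this⟩ }

/-- The space `Z_P = (T^m × P)/∼`. -/
def momentAngle : Type := Quotient P.torusSetoid

/-- `Z_P` carries the quotient topology. -/
instance : TopologicalSpace P.momentAngle :=
  inferInstanceAs (TopologicalSpace (Quotient P.torusSetoid))

/-- The class `[t, x]` of `(t, x)` in `Z_P`. -/
def toMomentAngle (t : Fin m → Circle) (x : P.carrier) : P.momentAngle :=
  Quotient.mk P.torusSetoid (t, x)

/-- The action of `T^m` on `Z_P`: `s • [t, x] = [s t, x]`. -/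
noncomputable instance : MulAction (Fin m → Circle) P.momentAngle where
  smul s := Quotient.map (fun a => (s * a.1, a.2)) (fun a b h => ⟨h.1, by
    have h2 : a.1⁻¹ * b.1 ∈ coordinateSubgroup (P.facetsThrough a.2) := h.2
    have e : (s * a.1)⁻¹ * (s * b.1) = a.1⁻¹ * b.1 := by group
    change (s * a.1)⁻¹ * (s * b.1) ∈ coordinateSubgroup (P.facetsThrough a.2)
    rw [e]
    exact h2⟩)
  one_smul := by
    rintro ⟨t, x⟩
    exact congrArg (Quotient.mk P.torusSetoid) (Prod.ext (one_mul t) rfl)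
  mul_smul := by
    rintro s s' ⟨t, x⟩
    exact congrArg (Quotient.mk P.torusSetoid) (Prod.ext (mul_assoc s s' t) rfl)

theorem smul_toMomentAngle (s t : Fin m → Circle) (x : P.carrier) :
    s • P.toMomentAngle t x = P.toMomentAngle (s * t) x := rfl

/-- The model `ℂⁿ × T^{m-n}` at a vertex `v`: there is a factor `ℂ` for each of the `n` facets
that contain `v`, and a factor `S¹` for each of the other `m - n` facets. -/
abbrev Block (v : EuclideanSpace ℝ (Fin n)) : Type :=
  ({i // v ∈ P.facet i} → ℂ) × ({i // v ∉ P.facet i} → Circle)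

/-- `φ` is the coordinate system on `Z_P` at the vertex `v`. It is defined over the union of the
relative interiors of the faces of `P` that contain `v`. It maps `[t, x]` to the point of
`ℂⁿ × T^{m-n}` with coordinates `tᵢ √(ℓ i x)` for the facets `Fᵢ` that contain `v`, and `tᵢ` for
the other facets. -/
def IsBlockChart (ℓ : Fin m → (EuclideanSpace ℝ (Fin n) →ᵃ[ℝ] ℝ))
    (v : EuclideanSpace ℝ (Fin n)) (φ : OpenPartialHomeomorph P.momentAngle (P.Block v)) : Prop :=
  φ.source = {z | ∃ (t : Fin m → Circle) (x : P.carrier),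
    P.facetsThrough x ⊆ P.facetsThrough v ∧ z = P.toMomentAngle t x} ∧
  ∀ (t : Fin m → Circle) (x : P.carrier), P.facetsThrough x ⊆ P.facetsThrough v →
    φ (P.toMomentAngle t x) =
      (fun i : {i // v ∈ P.facet i} => (t i : ℂ) * (Real.sqrt (ℓ i x) : ℂ),
        fun i : {i // v ∉ P.facet i} => t i)

open Classical in
/-- A smooth structure of dimension `m + n` on `Z_P` (without boundary) is canonical if, for every
vertex `v` of `P`, the coordinate system at `v` is a diffeomorphism onto an open subset of
`ℂⁿ × T^{m-n}`. -/
def IsCanonicalSmoothStructure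
    (cs : ChartedSpace (EuclideanSpace ℝ (Fin (m + n))) P.momentAngle) : Prop :=
  IsManifold (𝓡 (m + n)) ∞ P.momentAngle ∧
  ∀ ℓ, P.IsDefiningSystem ℓ → ∀ v ∈ P.carrier.extremePoints ℝ,
    ∃ φ : OpenPartialHomeomorph P.momentAngle (P.Block v), P.IsBlockChart ℓ v φ ∧
      ContMDiffOn (𝓡 (m + n))
        (𝓘(ℝ, {i // v ∈ P.facet i} → ℂ).prod
          (ModelWithCorners.pi fun _ : {i // v ∉ P.facet i} => 𝓡 1)) ∞ φ φ.source ∧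
      ContMDiffOn
        (𝓘(ℝ, {i // v ∈ P.facet i} → ℂ).prod
          (ModelWithCorners.pi fun _ : {i // v ∉ P.facet i} => 𝓡 1))
        (𝓡 (m + n)) ∞ φ.symm φ.target

end SimplePolytope

/-! Everything happens inside `ℂ^m`. The formula `tᵢ √(ℓ i x)` gives an injection `h.embedding` of
the compact space `Z_P`: the squared moduli recover `x`, and a phase is lost only where the radius
vanishes, which is exactly where `∼` forgets it. Hence it is a topological embedding, and `Z_P` is
Hausdorff and second countable. At a vertex `v`, simplicity makes the `n` functions `ℓ i` with `v ∈
Fᵢ` affine coordinates on `ℝⁿ`. Every other `ℓ j` is then a smooth function `sqRadius` of the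
coordinates `z i` at `v`, and the image is cut out by the `m - n` equations `‖z j‖ ^ 2 = sqRadius j
z` (`mem_range_embedding_iff_sqRadius`). Where the radii are positive, logarithms turn these into
`Re w j = 0` (`logChart`), so the image is a submanifold of dimension `2m - (m - n) = m + n`
(`exists_chartedSpace_of_slices`). Since the embedding is an immersion, smoothness of maps into
`Z_P` can be tested in `ℂ^m`; this handles the inverse block coordinates and the action. Block
coordinates determine the structure, because the identity between two canonical structures is the
identity in them. Rescaling to `ℓ i ≤ 1` puts the image in the polydisc. -/

/-! ### Smooth maps into and out of finite products of manifolds. -/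

section PiModel

variable {ι : Type*} [Fintype ι] {E : ι → Type*} [∀ i, NormedAddCommGroup (E i)]
  [∀ i, NormedSpace ℝ (E i)] {H : ι → Type*} [∀ i, TopologicalSpace (H i)]
  {I : ∀ i, ModelWithCorners ℝ (E i) (H i)} {M : ι → Type*} [∀ i, TopologicalSpace (M i)]
  [∀ i, ChartedSpace (H i) (M i)]
  {E' : Type*} [NormedAddCommGroup E'] [NormedSpace ℝ E'] {H' : Type*} [TopologicalSpace H']
  {J : ModelWithCorners ℝ E' H'} {N : Type*} [TopologicalSpace N] [ChartedSpace H' N]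
  {k : ℕ∞ω}

theorem contMDiffWithinAt_pi_of_forall {f : N → ∀ i, M i} {s : Set N} {x : N}
    (h : ∀ i, ContMDiffWithinAt J (I i) k (fun y => f y i) s x) :
    ContMDiffWithinAt J (ModelWithCorners.pi I) k f s x := by
  rw [contMDiffWithinAt_iff]
  refine ⟨continuousWithinAt_pi.2 fun i => (h i).continuousWithinAt, ?_⟩
  rw [contDiffWithinAt_pi]
  intro i
  exact (contMDiffWithinAt_iff.1 (h i)).2

/-- Product charts act coordinatewise, so in charts the evaluation is the linear projection on the
target of the extended chart. -/
theorem contMDiff_pi_eval (i : ι) :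
    ContMDiff (ModelWithCorners.pi I) (I i) k (fun p : ∀ i, M i => p i) := by
  intro p
  rw [contMDiffAt_iff]
  refine ⟨(continuous_apply i).continuousAt, ?_⟩
  have h1 : ContDiffWithinAt ℝ k (fun q : ∀ i, E i => q i) (Set.range (ModelWithCorners.pi I))
      (extChartAt (ModelWithCorners.pi I) p p) := (contDiff_pi.1 contDiff_id i).contDiffWithinAt
  refine h1.congr_of_eventuallyEq ?_ ?_
  · filter_upwards [extChartAt_target_mem_nhdsWithin (I := ModelWithCorners.pi I) p] with q hq
    obtain ⟨⟨y, hy⟩, hq'⟩ : (∃ y, ModelWithCorners.pi I y = q) ∧ (ModelWithCorners.pi I).symm q ∈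
        Set.univ.pi fun i => (chartAt (H i) (p i)).target := by simpa using! hq
    refine (extChartAt (I i) (p i)).right_inv ?_
    have h3 : (∃ y, I i y = q i) ∧ (I i).symm (q i) ∈ (chartAt (H i) (p i)).target :=
      ⟨⟨y i, congrFun hy i⟩, hq' i (Set.mem_univ i)⟩
    simpa using h3
  · exact congrArg _ ((extChartAt (I i) (p i)).left_inv (mem_extChartAt_source (p i)))

end PiModel

/-! ### The phase of a complex number. -/

section UnitPhase

/-- The point of the unit circle in the direction of `z`; it is `1` at `z = 0`. -/
noncomputable def unitPhase (z : ℂ) : Circle := Circle.exp z.arg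

theorem norm_mul_unitPhase (z : ℂ) : (‖z‖ : ℂ) * unitPhase z = z := by
  simp [unitPhase, Circle.coe_exp, Complex.norm_mul_exp_arg_mul_I]

theorem unitPhase_mul_ofReal (t : Circle) {r : ℝ} (hr : 0 < r) :
    unitPhase ((t : ℂ) * r) = t := by
  have h := norm_mul_unitPhase ((t : ℂ) * r)
  have hn : ‖(t : ℂ) * r‖ = r := by
    rw [norm_mul, Circle.norm_coe, one_mul, Complex.norm_of_nonneg hr.le]
  rw [hn, mul_comm] at h
  exact Circle.ext (mul_right_cancel₀ (by exact_mod_cast hr.ne') h)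

/-- `arg` jumps on the negative axis, so the phase of `w` is compared with that of `z`: the quotient
is the phase of `w / z`, which is near `1`, where `log` is smooth. -/
theorem contMDiffAt_unitPhase {z : ℂ} (hz : z ≠ 0) :
    ContMDiffAt 𝓘(ℝ, ℂ) (𝓡 1) ∞ unitPhase z := by
  have harg : ContDiffAt ℝ ∞ (fun w : ℂ => (Complex.log (w / z)).im) z := by
    have h1 : ContDiffAt ℂ ∞ Complex.log (z / z) := by
      rw [div_self hz]; exact Complex.contDiffAt_log (by simp)
    have h2 : ContDiffAt ℝ ∞ (fun w : ℂ => w / z) z := contDiffAt_id.div_const z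
    exact Complex.imCLM.contDiff.contDiffAt.comp z
      (ContDiffAt.comp (f := fun w : ℂ => w / z) z (h1.restrict_scalars ℝ) h2)
  have h : ContMDiffAt 𝓘(ℝ, ℂ) (𝓡 1) ∞
      (fun w => unitPhase z * Circle.exp (Complex.log (w / z)).im) z :=
    contMDiffAt_const.mul (contMDiff_circleExp.contMDiffAt.comp z harg.contMDiffAt)
  refine h.congr_of_eventuallyEq ?_
  filter_upwards [isOpen_ne.mem_nhds hz] with w hw
  have hw' : (‖w‖ : ℂ) ≠ 0 := by simpa using hw
  apply Circle.ext
  apply mul_left_cancel₀ hw'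
  rw [norm_mul_unitPhase, Complex.log_im]
  have h1 := norm_mul_unitPhase (w / z)
  have h2 := norm_mul_unitPhase z
  rw [norm_div, Complex.ofReal_div] at h1
  have h3 : (‖z‖ : ℂ) ≠ 0 := by simpa using hz
  change w = ‖w‖ * (unitPhase z * unitPhase (w / z) : Circle)
  rw [Circle.coe_mul]
  have h4 : (w : ℂ) = (w / z) * z := by field_simp
  rw [← h1] at h4
  calc w = _ := h4
    _ = ‖w‖ / ‖z‖ * unitPhase (w / z) * (‖z‖ * unitPhase z) := by rw [h2]
    _ = _ := by field_simp

theorem contMDiff_circle_coe : ContMDiff (𝓡 1) 𝓘(ℝ, ℂ) ∞ (fun t : Circle => (t : ℂ)) :=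
  haveI := Complex.finrank_real_complex_fact
  contMDiff_coe_sphere

end UnitPhase

/-! ### Submanifold structures from slice charts. -/

section Slices

open Topology

variable {V : Type*} [NormedAddCommGroup V] [NormedSpace ℝ V]
  {E : Type*} [NormedAddCommGroup E] [NormedSpace ℝ E]
  {F : Type*} [NormedAddCommGroup F] [NormedSpace ℝ F]
  {M : Type*} [TopologicalSpace M]

/-- The chart on `M` which is induced, along a topological embedding `i` into `V`, by a chart `Ψ` of
`V` that takes the range of `i` to the slice `E × {0}`. -/
noncomputable def sliceChart [Nonempty M] {i : M → V} (hi : IsEmbedding i)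
    (e : (E × F) ≃L[ℝ] V) (Ψ : OpenPartialHomeomorph V V)
    (hΨ : ∀ z ∈ Ψ.source, z ∈ Set.range i ↔ (e.symm (Ψ z)).2 = 0) : OpenPartialHomeomorph M E :=
  -- Slice points of the target come from the range of `i`, so `Function.invFun i` is a true inverse
  -- at them.
  have key : ∀ u, e (u, 0) ∈ Ψ.target →
      i (Function.invFun i (Ψ.symm (e (u, 0)))) = Ψ.symm (e (u, 0)) := fun u hu =>
    Function.invFun_eq ((hΨ _ (Ψ.map_target hu)).2 (by simp [Ψ.right_inv hu]))
  { toFun := fun p => (e.symm (Ψ (i p))).1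
    invFun := fun u => Function.invFun i (Ψ.symm (e (u, 0)))
    source := i ⁻¹' Ψ.source
    target := {u | e (u, 0) ∈ Ψ.target}
    map_source' := fun p hp => by
      have h : ((e.symm (Ψ (i p))).1, (0 : F)) = e.symm (Ψ (i p)) :=
        Prod.ext rfl ((hΨ _ hp).1 ⟨p, rfl⟩).symm
      simp only [Set.mem_ofPred_eq, h, e.apply_symm_apply]
      exact Ψ.map_source hp
    map_target' := fun u hu => by
      rw [Set.mem_preimage, key u hu]
      exact Ψ.map_target hu
    left_inv' := fun p hp => by
      have h : ((e.symm (Ψ (i p))).1, (0 : F)) = e.symm (Ψ (i p)) :=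
        Prod.ext rfl ((hΨ _ hp).1 ⟨p, rfl⟩).symm
      rw [h, e.apply_symm_apply, Ψ.left_inv hp]
      exact Function.leftInverse_invFun hi.injective p
    right_inv' := fun u hu => by
      rw [key u hu, Ψ.right_inv hu, e.symm_apply_apply]
    open_source := Ψ.open_source.preimage hi.continuous
    open_target := Ψ.open_target.preimage (by fun_prop)
    continuousOn_toFun := by
      have : ContinuousOn (fun p => Ψ (i p)) (i ⁻¹' Ψ.source) :=
        Ψ.continuousOn.comp hi.continuous.continuousOn (fun _ h => h)
      exact (continuous_fst.comp e.symm.continuous).comp_continuousOn this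
    continuousOn_invFun := by
      rw [hi.continuousOn_iff]
      refine ContinuousOn.congr (f := fun u => Ψ.symm (e (u, 0))) ?_ key
      exact Ψ.continuousOn_symm.comp (by fun_prop) (fun _ h => h) }

theorem apply_sliceChart_symm [Nonempty M] {i : M → V} (hi : IsEmbedding i)
    (e : (E × F) ≃L[ℝ] V) (Ψ : OpenPartialHomeomorph V V)
    (hΨ : ∀ z ∈ Ψ.source, z ∈ Set.range i ↔ (e.symm (Ψ z)).2 = 0) {u : E}
    (hu : u ∈ (sliceChart hi e Ψ hΨ).target) :
    i ((sliceChart hi e Ψ hΨ).symm u) = Ψ.symm (e (u, 0)) :=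
  Function.invFun_eq ((hΨ _ (Ψ.map_target hu)).2 (by simp [Ψ.right_inv hu]))

/-- A subspace of `V` around each of whose points `V` has a chart that flattens the subspace
to a slice is an embedded submanifold. -/
theorem exists_chartedSpace_of_slices {i : M → V} (hi : IsEmbedding i)
    (h : ∀ p, ∃ (e : (E × F) ≃L[ℝ] V) (Ψ : OpenPartialHomeomorph V V), i p ∈ Ψ.source ∧
      ContDiffOn ℝ ∞ Ψ Ψ.source ∧ ContDiffOn ℝ ∞ Ψ.symm Ψ.target ∧
      ∀ z ∈ Ψ.source, z ∈ Set.range i ↔ (e.symm (Ψ z)).2 = 0) :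
    ∃ _ : ChartedSpace E M, IsManifold 𝓘(ℝ, E) ∞ M ∧
      Manifold.IsSmoothEmbedding 𝓘(ℝ, E) 𝓘(ℝ, V) ∞ i := by
  choose e Ψ hp hs ht hsl using h
  let c : M → OpenPartialHomeomorph M E := fun p =>
    haveI : Nonempty M := ⟨p⟩
    sliceChart hi (e p) (Ψ p) (hsl p)
  let _ : ChartedSpace E M :=
    { atlas := Set.range c
      chartAt := c
      mem_chart_source := hp
      chart_mem_atlas := fun p => ⟨p, rfl⟩ }
  have hman : IsManifold 𝓘(ℝ, E) ∞ M := by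
    apply isManifold_of_contDiffOn
    rintro _ _ ⟨p, rfl⟩ ⟨q, rfl⟩
    have : Nonempty M := ⟨p⟩
    simp only [modelWithCornersSelf_coe, modelWithCornersSelf_coe_symm, Set.range_id,
      Set.inter_univ, Function.comp_id, Function.id_comp, Set.preimage_id]
    -- The inclusion cancels, so a transition map is the ambient one restricted to the slice.
    have h1 : ContDiffOn ℝ ∞ (fun u => ((e q).symm (Ψ q ((Ψ p).symm (e p (u, 0))))).1)
        ((c p).symm.trans (c q)).source := by
      refine (contDiff_fst.comp (e q).symm.contDiff).comp_contDiffOn ((hs q).comp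
        ((ht p).comp ((e p).contDiff.comp (contDiff_id.prodMk contDiff_const)).contDiffOn ?_) ?_)
      · intro u hu
        exact hu.1
      · intro u hu
        have hq : i ((c p).symm u) ∈ (Ψ q).source := hu.2
        rwa [apply_sliceChart_symm hi (e p) (Ψ p) (hsl p) hu.1] at hq
    refine h1.congr fun u hu => ?_
    change ((e q).symm (Ψ q (i ((c p).symm u)))).1 = _
    rw [apply_sliceChart_symm hi (e p) (Ψ p) (hsl p) hu.1]
  refine ⟨inferInstance, hman, ?_, hi⟩
  refine Manifold.IsImmersionOfComplement.isImmersion (F := F) fun p => ?_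
  have : Nonempty M := ⟨p⟩
  -- In these charts `i` is `u ↦ (u, 0)`, the normal form of an immersion.
  refine Manifold.IsImmersionAtOfComplement.mk_of_charts (e p) (c p) (Ψ p) (hp p) (hp p)
    (IsManifold.subset_maximalAtlas ⟨p, rfl⟩)
    ((Ψ p).mem_maximalAtlas_of_contMDiffOn (contMDiffOn_iff_contDiffOn.2 (hs p))
      (contMDiffOn_iff_contDiffOn.2 (ht p))) subset_rfl ?_
  intro u hu
  have hu' : u ∈ (c p).target := by simpa using hu
  change Ψ p (i ((c p).symm u)) = e p (u, 0)
  rw [apply_sliceChart_symm hi (e p) (Ψ p) (hsl p) hu', (Ψ p).right_inv hu']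

end Slices

/-! ### Comparing maximal atlases. -/

section MaximalAtlas

variable {E H M M' : Type*} [NormedAddCommGroup E]
  [NormedSpace ℝ E] [TopologicalSpace H] {I : ModelWithCorners ℝ E H} [TopologicalSpace M]
  [TopologicalSpace M'] {k : ℕ∞ω}

theorem Homeomorph.trans_mem_maximalAtlas [ChartedSpace H M] [ChartedSpace H M']
    [IsManifold I k M] [IsManifold I k M'] (e : M' ≃ₜ M) (h : ContMDiff I I k e)
    (h' : ContMDiff I I k e.symm) {φ : OpenPartialHomeomorph M H}
    (hφ : φ ∈ IsManifold.maximalAtlas I k M) :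
    e.transOpenPartialHomeomorph φ ∈ IsManifold.maximalAtlas I k M' := by
  rw [IsManifold.mem_maximalAtlas_iff_contMDiffOn] at hφ ⊢
  exact ⟨hφ.1.comp h.contMDiffOn fun _ hx => hx, h'.comp_contMDiffOn hφ.2⟩

theorem maximalAtlas_subset_of_contMDiff_id (c c' : ChartedSpace H M)
    (hc : @IsManifold ℝ _ _ _ _ _ _ I k M _ c) (hc' : @IsManifold ℝ _ _ _ _ _ _ I k M _ c')
    (h : @ContMDiff ℝ _ _ _ _ _ _ I M _ c _ _ _ _ _ I M _ c' k id)
    (h' : @ContMDiff ℝ _ _ _ _ _ _ I M _ c' _ _ _ _ _ I M _ c k id) :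
    @IsManifold.maximalAtlas ℝ _ _ _ _ _ _ I k M _ c ⊆
      @IsManifold.maximalAtlas ℝ _ _ _ _ _ _ I k M _ c' := by
  intro φ hφ
  have := @Homeomorph.trans_mem_maximalAtlas _ _ _ _ _ _ _ I _ _ k c c' hc hc'
    (Homeomorph.refl M) h' h φ hφ
  convert this using 1
  exact OpenPartialHomeomorph.ext _ _ (fun _ => rfl) (fun _ => rfl) rfl

end MaximalAtlas

/-! ### Convex geometry of a simple polytope. -/

namespace SimplePolytope

variable {n m : ℕ} (P : SimplePolytope n m)

variable {P} {ℓ ℓ' : Fin m → (EuclideanSpace ℝ (Fin n) →ᵃ[ℝ] ℝ)}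

theorem continuous_affine (f : EuclideanSpace ℝ (Fin n) →ᵃ[ℝ] ℝ) : Continuous f :=
  f.continuous_of_finiteDimensional

theorem IsDefiningSystem.mem_carrier (h : P.IsDefiningSystem ℓ) {x : EuclideanSpace ℝ (Fin n)} :
    x ∈ P.carrier ↔ ∀ i, 0 ≤ ℓ i x := by rw [h.1]; rfl

theorem IsDefiningSystem.mem_facet (h : P.IsDefiningSystem ℓ) {x : EuclideanSpace ℝ (Fin n)}
    (hx : x ∈ P.carrier) {i : Fin m} : x ∈ P.facet i ↔ ℓ i x = 0 := by
  rw [h.2]; exact and_iff_right hx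

theorem IsDefiningSystem.pos (h : P.IsDefiningSystem ℓ) {x : EuclideanSpace ℝ (Fin n)}
    (hx : x ∈ P.carrier) {i : Fin m} (hi : x ∉ P.facet i) : 0 < ℓ i x :=
  (h.mem_carrier.1 hx i).lt_of_ne fun h0 => hi ((h.mem_facet hx).2 h0.symm)

theorem isCompact_carrier : IsCompact P.carrier := by
  obtain ⟨ℓ, h, -⟩ := P.exists_halfspaces
  refine Metric.isCompact_of_isClosed_isBounded ?_ P.isBounded
  rw [h, Set.ofPred_forall]
  exact isClosed_iInter fun i => isClosed_le continuous_const (continuous_affine (ℓ i))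

/-- Every point of `P` lies in the relative interior of a face that has a vertex of `P`. -/
theorem exists_vertex {x : EuclideanSpace ℝ (Fin n)} (hx : x ∈ P.carrier) :
    ∃ v ∈ P.carrier.extremePoints ℝ, P.facetsThrough x ⊆ P.facetsThrough v := by
  obtain ⟨ℓ, h⟩ := P.exists_halfspaces
  have h : P.IsDefiningSystem ℓ := h
  let A : Set (EuclideanSpace ℝ (Fin n)) := {y ∈ P.carrier | ∀ i ∈ P.facetsThrough x, ℓ i y = 0}
  have hA : IsCompact A := by
    refine P.isCompact_carrier.inter_right ?_
    have e : {y : EuclideanSpace ℝ (Fin n) | ∀ i ∈ P.facetsThrough x, ℓ i y = 0} =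
        ⋂ i ∈ P.facetsThrough x, {y | ℓ i y = 0} := by ext; simp
    change IsClosed {y : EuclideanSpace ℝ (Fin n) | ∀ i ∈ P.facetsThrough x, ℓ i y = 0}
    rw [e]
    exact isClosed_biInter fun i _ => isClosed_eq (continuous_affine (ℓ i)) continuous_const
  -- If nonnegative values average to `0` with positive weights, they all vanish; so `A` is a face,
  -- and its extreme points are vertices of `P`.
  have hext : IsExtreme ℝ P.carrier A := by
    refine ⟨fun y hy => hy.1, ?_⟩
    rintro y hy z hz w hw ⟨a, b, ha, hb, hab, rfl⟩
    refine ⟨hy, fun i hi => ?_⟩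
    have h0 := hw.2 i hi
    rw [Convex.combo_affine_apply hab] at h0
    have h1 := h.mem_carrier.1 hy i
    have h2 := h.mem_carrier.1 hz i
    simp only [smul_eq_mul] at h0
    nlinarith [mul_nonneg ha.le h1, mul_nonneg hb.le h2]
  obtain ⟨v, hv⟩ := hA.extremePoints_nonempty ⟨x, hx, fun i hi => (h.mem_facet hx).1 hi⟩
  refine ⟨v, hext.extremePoints_subset_extremePoints hv, fun i hi => ?_⟩
  have hvA : v ∈ A := hv.1
  exact (h.mem_facet hvA.1).2 (hvA.2 i hi)

theorem carrier_nonempty : P.carrier.Nonempty := P.interior_nonempty.mono interior_subset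

theorem exists_extremePoint : (P.carrier.extremePoints ℝ).Nonempty :=
  P.isCompact_carrier.extremePoints_nonempty P.carrier_nonempty

open Classical in
theorem card_facets_vertex {v : EuclideanSpace ℝ (Fin n)} (hv : v ∈ P.carrier.extremePoints ℝ) :
    Fintype.card {i // v ∈ P.facet i} = n := by
  have := P.ncard_facets_vertex v hv
  rwa [← Nat.card_coe_set_eq, Nat.card_eq_fintype_card] at this

/-- The linear parts of the functions `ℓ i` of the facets through a vertex separate points. -/
theorem IsDefiningSystem.eq_zero_of_linear (h : P.IsDefiningSystem ℓ)
    {v : EuclideanSpace ℝ (Fin n)} (hv : v ∈ P.carrier.extremePoints ℝ)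
    {w : EuclideanSpace ℝ (Fin n)} (hw : ∀ i, v ∈ P.facet i → (ℓ i).linear w = 0) : w = 0 := by
  -- Moving along `w` keeps the vanishing `ℓ i` at `0` and the others positive for small `s`. So `v`
  -- is the midpoint of `v ± s • w` in `P`, and extremality forces `w = 0`.
  have hline : ∀ᶠ s : ℝ in nhds 0, v + s • w ∈ P.carrier := by
    simp only [h.mem_carrier, Filter.eventually_all]
    intro i
    have e : ∀ s : ℝ, ℓ i (v + s • w) = s * (ℓ i).linear w + ℓ i v := fun s => by
      rw [add_comm v, ← vadd_eq_add, AffineMap.map_vadd]; simp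
    simp only [e]
    by_cases hi : v ∈ P.facet i
    · simp [hw i hi, h.mem_carrier.1 hv.1 i]
    · have : Filter.Tendsto (fun s : ℝ => s * (ℓ i).linear w + ℓ i v) (nhds 0)
          (nhds (0 * (ℓ i).linear w + ℓ i v)) := by
        exact Continuous.tendsto (by fun_prop) 0
      rw [zero_mul, zero_add] at this
      exact (this.eventually (lt_mem_nhds (h.pos hv.1 hi))).mono fun _ => le_of_lt
  have hline' : ∀ᶠ s : ℝ in nhds 0, v + (-s) • w ∈ P.carrier := by
    have : Filter.Tendsto (fun s : ℝ => -s) (nhds 0) (nhds 0) := by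
      simpa using (continuous_neg (G := ℝ)).tendsto 0
    exact this.eventually hline
  obtain ⟨s, ⟨h1, h2⟩, hs⟩ :=
    (((hline.and hline').filter_mono nhdsWithin_le_nhds).and
      (self_mem_nhdsWithin : Set.Ioi (0 : ℝ) ∈ nhdsWithin 0 (Set.Ioi 0))).exists
  have hs : 0 < s := hs
  have := (mem_extremePoints.1 hv).2 _ h1 _ h2
    ⟨1 / 2, 1 / 2, by norm_num, by norm_num, by norm_num, by module⟩
  have h3 : s • w = 0 := by simpa using this.1
  exact (smul_eq_zero.1 h3).resolve_left hs.ne'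

open Classical in
/-- The functions `ℓ i` of the facets through a vertex are affine coordinates on `ℝⁿ`. -/
theorem IsDefiningSystem.exists_affine_inverse (h : P.IsDefiningSystem ℓ)
    {v : EuclideanSpace ℝ (Fin n)} (hv : v ∈ P.carrier.extremePoints ℝ) :
    ∃ K : ({i // v ∈ P.facet i} → ℝ) → EuclideanSpace ℝ (Fin n), ContDiff ℝ ∞ K ∧
      (∀ y (i : {i // v ∈ P.facet i}), ℓ i (K y) = y i) ∧
      ∀ x y, (∀ i : {i // v ∈ P.facet i}, ℓ i x = y i) → x = K y := by
  let Λ : EuclideanSpace ℝ (Fin n) →ₗ[ℝ] ({i // v ∈ P.facet i} → ℝ) :=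
    LinearMap.pi fun i => (ℓ i).linear
  have hinj : Function.Injective Λ := by
    rw [injective_iff_map_eq_zero]
    exact fun w hw => h.eq_zero_of_linear hv fun i hi => congrFun hw ⟨i, hi⟩
  -- Simplicity is used here: `n` facets at `v` make the injective `Λ` bijective.
  let e := Λ.linearEquivOfInjective hinj (by simp [card_facets_vertex hv])
  have he : ∀ w i, e w i = (ℓ i).linear w := fun w i => by
    rw [LinearMap.linearEquivOfInjective_apply]; rfl
  have hℓ : ∀ x (i : {i // v ∈ P.facet i}), ℓ i x = e (x - v) i := fun x i => by
    rw [he, ← vsub_eq_sub, AffineMap.linearMap_vsub, (h.mem_facet hv.1).1 i.2]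
    simp
  refine ⟨fun y => e.symm y + v,
    (e.symm.toLinearMap.toContinuousLinearMap.contDiff).add contDiff_const,
    fun y i => by simp [hℓ], fun x y hxy => ?_⟩
  have : e (x - v) = y := funext fun i => by rw [← hℓ, hxy]
  rw [← this]
  simp

/-- A facet containing `P` would span `ℝⁿ`, as `P` has interior points, but its dimension is `n -
1`. -/
theorem exists_notMem_facet (P : SimplePolytope n m) (i : Fin m) :
    ∃ x ∈ P.carrier, x ∉ P.facet i := by
  by_contra! hc
  have h1 : affineSpan ℝ (P.facet i) = ⊤ :=
    top_le_iff.1 ((isOpen_interior.affineSpan_eq_top P.interior_nonempty).symm.le.trans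
      (affineSpan_mono ℝ fun x hx => hc x (interior_subset hx)))
  have h2 := AffineSubspace.vectorSpan_eq_top_of_affineSpan_eq_top ℝ _ _ h1
  have h3 := P.finrank_facet i
  rw [h2, finrank_top, finrank_euclideanSpace_fin] at h3
  omega

theorem IsDefiningSystem.vectorSpan_facet_le (h : P.IsDefiningSystem ℓ) (i : Fin m) :
    vectorSpan ℝ (P.facet i) ≤ LinearMap.ker (ℓ i).linear := by
  rw [vectorSpan_def, Submodule.span_le]
  rintro _ ⟨x, hx, y, hy, rfl⟩
  rw [h.2] at hx hy
  simp [AffineMap.linearMap_vsub, hx.2, hy.2, -vsub_eq_sub]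

theorem IsDefiningSystem.vectorSpan_facet (h : P.IsDefiningSystem ℓ) (i : Fin m) :
    vectorSpan ℝ (P.facet i) = LinearMap.ker (ℓ i).linear := by
  refine Submodule.eq_of_le_of_finrank_le (h.vectorSpan_facet_le i) ?_
  have h1 : LinearMap.ker (ℓ i).linear ≠ ⊤ := fun htop => by
    obtain ⟨x, hx, hxi⟩ := P.exists_notMem_facet i
    obtain ⟨p, hp⟩ := P.facet_nonempty i
    rw [h.2] at hp
    have : (ℓ i).linear (x -ᵥ p) = 0 := LinearMap.mem_ker.1 (htop ▸ Submodule.mem_top)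
    rw [AffineMap.linearMap_vsub, hp.2] at this
    exact (h.pos hx hxi).ne' (by simpa using this)
  have h2 := Submodule.finrank_lt h1
  rw [finrank_euclideanSpace_fin] at h2
  have h3 := P.finrank_facet i
  omega

/-- The functions of a defining system are determined up to positive factors. -/
theorem IsDefiningSystem.exists_pos_mul (h : P.IsDefiningSystem ℓ) (h' : P.IsDefiningSystem ℓ')
    (i : Fin m) : ∃ c : ℝ, 0 < c ∧ ∀ x, ℓ' i x = c * ℓ i x := by
  obtain ⟨x, hx, hxi⟩ := P.exists_notMem_facet i
  obtain ⟨p, hp⟩ := P.facet_nonempty i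
  have h0 : ℓ i p = 0 := by rw [h.2] at hp; exact hp.2
  have h0' : ℓ' i p = 0 := by rw [h'.2] at hp; exact hp.2
  have hl : ∀ y, ℓ i y = (ℓ i).linear (y -ᵥ p) := fun y => by
    rw [AffineMap.linearMap_vsub, h0]; simp
  have hl' : ∀ y, ℓ' i y = (ℓ' i).linear (y -ᵥ p) := fun y => by
    rw [AffineMap.linearMap_vsub, h0']; simp
  have hpos := h.pos hx hxi
  refine ⟨ℓ' i x / ℓ i x, div_pos (h'.pos hx hxi) hpos, fun y => ?_⟩
  -- Both linear parts have the direction space of the facet as kernel, so a vector killed by one is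
  -- killed by the other.
  have hk : (y -ᵥ p) - (ℓ i y / ℓ i x) • (x -ᵥ p) ∈ LinearMap.ker (ℓ i).linear := by
    rw [LinearMap.mem_ker, map_sub, map_smul, ← hl, ← hl, smul_eq_mul]
    field_simp
    ring
  rw [← h.vectorSpan_facet, h'.vectorSpan_facet, LinearMap.mem_ker, map_sub, map_smul, ← hl',
    ← hl', smul_eq_mul] at hk
  rw [sub_eq_zero.1 hk]
  ring

theorem exists_isDefiningSystem_le_one (P : SimplePolytope n m) :
    ∃ ℓ, P.IsDefiningSystem ℓ ∧ ∀ x ∈ P.carrier, ∀ i, ℓ i x ≤ 1 := by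
  obtain ⟨ℓ, h⟩ := P.exists_halfspaces
  have h : P.IsDefiningSystem ℓ := h
  have hb : ∀ i, ∃ b : ℝ, 0 < b ∧ ∀ x ∈ P.carrier, ℓ i x ≤ b := fun i => by
    obtain ⟨b, hb⟩ := P.isCompact_carrier.bddAbove_image (continuous_affine (ℓ i)).continuousOn
    -- The maximum with `1` makes the bound positive, so dividing by it preserves the inequalities.
    exact ⟨max b 1, by positivity, fun x hx => (hb ⟨x, hx, rfl⟩).trans (le_max_left _ _)⟩
  choose b hb0 hb using hb
  refine ⟨fun i => (b i)⁻¹ • ℓ i, ⟨?_, fun i => ?_⟩, fun x hx i => ?_⟩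
  · ext x
    rw [h.mem_carrier]
    exact forall_congr' fun i => by simp [inv_pos.2 (hb0 i), mul_nonneg_iff_of_pos_left]
  · ext x
    rw [h.2]
    simp [(hb0 i).ne']
  · simpa using (inv_mul_le_one₀ (hb0 i)).2 (hb i x hx)

end SimplePolytope

/-! ### A linear splitting with prescribed kernel. -/

section Splitting

variable {V E F : Type*} [NormedAddCommGroup V] [NormedSpace ℝ V] [FiniteDimensional ℝ V]
  [NormedAddCommGroup E] [NormedSpace ℝ E] [FiniteDimensional ℝ E]
  [NormedAddCommGroup F] [NormedSpace ℝ F] [FiniteDimensional ℝ F]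
  {F' : Type*} [AddCommGroup F'] [Module ℝ F'] [FiniteDimensional ℝ F']

theorem exists_equiv_prod_of_surjective (R : V →ₗ[ℝ] F') (hR : Function.Surjective R)
    (hF : Module.finrank ℝ F' = Module.finrank ℝ F)
    (hV : Module.finrank ℝ V = Module.finrank ℝ E + Module.finrank ℝ F) :
    ∃ e : (E × F) ≃L[ℝ] V, ∀ w, (e.symm w).2 = 0 ↔ R w = 0 := by
  have hk : Module.finrank ℝ (LinearMap.ker R) = Module.finrank ℝ E := by
    have h1 := R.finrank_range_add_finrank_ker
    rw [LinearMap.range_eq_top.2 hR, finrank_top] at h1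
    omega
  let ρ := LinearEquiv.ofFinrankEq F' F hF
  let σ := LinearEquiv.ofFinrankEq (LinearMap.ker R) E hk
  obtain ⟨κ, hκ⟩ := (LinearMap.ker R).subtype.exists_leftInverse_of_injective
    (LinearMap.ker_eq_bot.2 Subtype.val_injective)
  let f : V →ₗ[ℝ] E × F := (σ.toLinearMap.comp κ).prod (ρ.toLinearMap.comp R)
  have hf : Function.Injective f := by
    rw [injective_iff_map_eq_zero]
    intro w hw
    have h1 : σ (κ w) = 0 := congrArg Prod.fst hw
    have h2 : ρ (R w) = 0 := congrArg Prod.snd hw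
    rw [LinearEquiv.map_eq_zero_iff] at h1 h2
    have h3 : κ w = ⟨w, h2⟩ := LinearMap.congr_fun hκ ⟨w, h2⟩
    rw [h1] at h3
    exact (congrArg Subtype.val h3).symm
  have hd : Module.finrank ℝ V = Module.finrank ℝ (E × F) := by rw [Module.finrank_prod, hV]
  let e := (f.linearEquivOfInjective hf hd).toContinuousLinearEquiv
  refine ⟨e.symm, fun w => ?_⟩
  have : (e w).2 = ρ (R w) := by
    change (f.linearEquivOfInjective hf hd w).2 = _
    rw [LinearMap.linearEquivOfInjective_apply]
    rfl
  rw [ContinuousLinearEquiv.symm_symm, this, LinearEquiv.map_eq_zero_iff]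

end Splitting

/-! ### The embedding into `ℂ^m` and the block coordinates. -/

namespace SimplePolytope

variable {n m : ℕ} {P : SimplePolytope n m}
  {ℓ ℓ' : Fin m → (EuclideanSpace ℝ (Fin n) →ᵃ[ℝ] ℝ)}

theorem exists_toMomentAngle_eq (z : P.momentAngle) : ∃ t x, z = P.toMomentAngle t x := by
  obtain ⟨⟨t, x⟩, rfl⟩ := Quotient.exists_rep z
  exact ⟨t, x, rfl⟩

namespace IsDefiningSystem

/-- The map `Z_P → ℂ^m` with coordinates `tᵢ √(ℓ i x)`. -/
noncomputable def embedding (h : P.IsDefiningSystem ℓ) : P.momentAngle → (Fin m → ℂ) :=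
  Quotient.lift (fun a j => (a.1 j : ℂ) * (Real.sqrt (ℓ j a.2) : ℂ)) <| by
    rintro ⟨t, x⟩ ⟨s, y⟩ ⟨rfl, hts⟩
    funext j
    by_cases hj : (x : EuclideanSpace ℝ (Fin n)) ∈ P.facet j
    · simp [(h.mem_facet x.2).1 hj]
    · have : (t⁻¹ * s) j = 1 := hts j hj
      have : t j = s j := by simpa [inv_mul_eq_one] using this
      simp [this]

theorem embedding_mk (h : P.IsDefiningSystem ℓ) (t : Fin m → Circle) (x : P.carrier) (j : Fin m) :
    h.embedding (P.toMomentAngle t x) j = (t j : ℂ) * (Real.sqrt (ℓ j x) : ℂ) := rfl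

theorem embedding_smul (h : P.IsDefiningSystem ℓ) (t : Fin m → Circle) (z : P.momentAngle)
    (j : Fin m) : h.embedding (t • z) j = (t j : ℂ) * h.embedding z j := by
  obtain ⟨s, x, rfl⟩ := exists_toMomentAngle_eq z
  simp [smul_toMomentAngle, embedding_mk, mul_assoc]

theorem norm_embedding (h : P.IsDefiningSystem ℓ) (t : Fin m → Circle) (x : P.carrier)
    (j : Fin m) : ‖h.embedding (P.toMomentAngle t x) j‖ = Real.sqrt (ℓ j x) := by
  rw [embedding_mk, norm_mul, Circle.norm_coe, one_mul,
    Complex.norm_of_nonneg (Real.sqrt_nonneg _)]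

theorem sq_norm_embedding (h : P.IsDefiningSystem ℓ) (t : Fin m → Circle) (x : P.carrier)
    (j : Fin m) : ‖h.embedding (P.toMomentAngle t x) j‖ ^ 2 = ℓ j x := by
  rw [norm_embedding, Real.sq_sqrt (h.mem_carrier.1 x.2 j)]

theorem embedding_eq_zero_iff (h : P.IsDefiningSystem ℓ) (t : Fin m → Circle) (x : P.carrier)
    (j : Fin m) :
    h.embedding (P.toMomentAngle t x) j = 0 ↔ (x : EuclideanSpace ℝ (Fin n)) ∈ P.facet j := by
  rw [h.mem_facet x.2, ← h.sq_norm_embedding t x]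
  simp

theorem continuous_embedding (h : P.IsDefiningSystem ℓ) : Continuous h.embedding := by
  refine Continuous.quotient_lift ?_ _
  refine continuous_pi fun j => ?_
  have h1 : Continuous fun a : (Fin m → Circle) × P.carrier => ℓ j a.2 :=
    (continuous_affine (ℓ j)).comp (by fun_prop)
  have h2 : Continuous fun a : (Fin m → Circle) × P.carrier => (a.1 j : ℂ) :=
    continuous_subtype_val.comp ((continuous_apply j).comp continuous_fst)
  exact h2.mul (Complex.continuous_ofReal.comp (Real.continuous_sqrt.comp h1))

theorem ext_of_eq (h : P.IsDefiningSystem ℓ) {x y : EuclideanSpace ℝ (Fin n)}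
    (hxy : ∀ j, ℓ j x = ℓ j y) : x = y := by
  obtain ⟨v, hv⟩ := P.exists_extremePoint
  obtain ⟨K, -, -, hK⟩ := h.exists_affine_inverse hv
  rw [hK x (fun i => ℓ i x) fun _ => rfl, hK y (fun i => ℓ i x) fun i => (hxy i).symm]

theorem embedding_injective (h : P.IsDefiningSystem ℓ) : Function.Injective h.embedding := by
  intro z w hzw
  obtain ⟨t, x, rfl⟩ := exists_toMomentAngle_eq z
  obtain ⟨s, y, rfl⟩ := exists_toMomentAngle_eq w
  have hxy : x = y := Subtype.ext <| h.ext_of_eq fun j => by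
    rw [← h.sq_norm_embedding t x, ← h.sq_norm_embedding s y, hzw]
  subst hxy
  refine Quotient.sound ⟨rfl, fun j hj => ?_⟩
  have h1 := congrFun hzw j
  rw [embedding_mk, embedding_mk] at h1
  have h2 : (Real.sqrt (ℓ j x) : ℂ) ≠ 0 := by
    exact_mod_cast (Real.sqrt_pos.2 (h.pos x.2 hj)).ne'
  have h3 : t j = s j := Circle.ext (mul_right_cancel₀ h2 h1)
  simp [h3]

end IsDefiningSystem

instance : CompactSpace P.momentAngle := by
  have : CompactSpace P.carrier := isCompact_iff_compactSpace.1 P.isCompact_carrier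
  exact inferInstanceAs (CompactSpace (Quotient P.torusSetoid))

instance : Nonempty P.momentAngle :=
  let ⟨x, hx⟩ := P.carrier_nonempty
  ⟨P.toMomentAngle 1 ⟨x, hx⟩⟩

namespace IsDefiningSystem

/-- A continuous injection from a compact space to a Hausdorff space is a closed embedding. -/
theorem isEmbedding_embedding (h : P.IsDefiningSystem ℓ) : Topology.IsEmbedding h.embedding :=
  (h.continuous_embedding.isClosedEmbedding h.embedding_injective).isEmbedding

/-- Membership depends only on the moduli: any phases can be realised, and at `z j = 0` the default
phase `1` is multiplied by `0`. -/
theorem mem_range_embedding (h : P.IsDefiningSystem ℓ) {z : Fin m → ℂ} :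
    z ∈ Set.range h.embedding ↔ ∃ x, ∀ j, ℓ j x = ‖z j‖ ^ 2 := by
  constructor
  · rintro ⟨p, rfl⟩
    obtain ⟨t, x, rfl⟩ := exists_toMomentAngle_eq p
    exact ⟨x, fun j => (h.sq_norm_embedding t x j).symm⟩
  · rintro ⟨x, hx⟩
    have hxP : x ∈ P.carrier := h.mem_carrier.2 fun j => hx j ▸ sq_nonneg _
    refine ⟨P.toMomentAngle (fun j => unitPhase (z j)) ⟨x, hxP⟩, funext fun j => ?_⟩
    rw [embedding_mk, hx, Real.sqrt_sq (norm_nonneg _), mul_comm, norm_mul_unitPhase]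

/-- The embeddings which belong to two defining systems differ by a rescaling of the coordinates. -/
theorem exists_embedding_eq_mul (h : P.IsDefiningSystem ℓ) (h' : P.IsDefiningSystem ℓ') :
    ∃ c : Fin m → ℝ, ∀ p, h'.embedding p = fun j => c j • h.embedding p j := by
  choose c hc0 hc using h.exists_pos_mul h'
  refine ⟨fun j => Real.sqrt (c j), fun p => ?_⟩
  obtain ⟨t, x, rfl⟩ := exists_toMomentAngle_eq p
  funext j
  rw [embedding_mk, embedding_mk, hc, Real.sqrt_mul (hc0 j).le, Complex.real_smul]
  push_cast
  ring

section Vertex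

open Classical

variable (h : P.IsDefiningSystem ℓ) {v : EuclideanSpace ℝ (Fin n)}
  (hv : v ∈ P.carrier.extremePoints ℝ)

/-- The value of `ℓ j` at the point of `ℝⁿ` where `ℓ i` has the value `‖z i‖ ^ 2` for all facets `Fᵢ`
through the vertex `v`. -/
noncomputable def sqRadius (j : Fin m) (z : {i // v ∈ P.facet i} → ℂ) : ℝ :=
  ℓ j ((h.exists_affine_inverse hv).choose fun i => ‖z i‖ ^ 2)

theorem contDiff_sqRadius (j : Fin m) : ContDiff ℝ ∞ (h.sqRadius hv j) := by
  have h1 : ContDiff ℝ ∞ (ℓ j) := by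
    rw [(ℓ j).decomp]
    exact (ℓ j).linear.toContinuousLinearMap.contDiff.add contDiff_const
  refine h1.comp ((h.exists_affine_inverse hv).choose_spec.1.comp ?_)
  exact contDiff_pi.2 fun i => (contDiff_apply ℝ ℂ i).norm_sq ℝ

theorem sqRadius_of_mem {j : Fin m} (hj : v ∈ P.facet j) (z : {i // v ∈ P.facet i} → ℂ) :
    h.sqRadius hv j z = ‖z ⟨j, hj⟩‖ ^ 2 :=
  (h.exists_affine_inverse hv).choose_spec.2.1 (fun i => ‖z i‖ ^ 2) ⟨j, hj⟩

/-- The coordinates at `v` already determine `x`; eliminating it leaves one equation for each facet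
that misses `v`. -/
theorem mem_range_embedding_iff_sqRadius {z : Fin m → ℂ} :
    z ∈ Set.range h.embedding ↔
      ∀ j, v ∉ P.facet j → h.sqRadius hv j (fun i => z i) = ‖z j‖ ^ 2 := by
  rw [h.mem_range_embedding]
  constructor
  · rintro ⟨x, hx⟩ j -
    rw [sqRadius, ← (h.exists_affine_inverse hv).choose_spec.2.2 x _ fun i => hx i, hx]
  · intro hz
    refine ⟨(h.exists_affine_inverse hv).choose fun i => ‖z i‖ ^ 2, fun j => ?_⟩
    by_cases hj : v ∈ P.facet j
    · exact h.sqRadius_of_mem hv hj fun i => z i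
    · exact hz j hj

/-- The inverse of the block coordinates at `v`, followed by the embedding into `ℂ^m`. -/
noncomputable def blockInv (b : P.Block v) (j : Fin m) : ℂ :=
  if hj : v ∈ P.facet j then b.1 ⟨j, hj⟩
  else Real.sqrt (h.sqRadius hv j b.1) • (b.2 ⟨j, hj⟩ : ℂ)

theorem blockInv_of_mem (b : P.Block v) {j : Fin m} (hj : v ∈ P.facet j) :
    h.blockInv hv b j = b.1 ⟨j, hj⟩ := dif_pos hj

theorem blockInv_of_notMem (b : P.Block v) {j : Fin m} (hj : v ∉ P.facet j) :
    h.blockInv hv b j = Real.sqrt (h.sqRadius hv j b.1) • (b.2 ⟨j, hj⟩ : ℂ) := dif_neg hj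

theorem blockInv_mem_range {b : P.Block v} (hb : ∀ j, v ∉ P.facet j → 0 < h.sqRadius hv j b.1) :
    h.blockInv hv b ∈ Set.range h.embedding := by
  rw [h.mem_range_embedding_iff_sqRadius hv]
  intro j hj
  have : (fun i : {i // v ∈ P.facet i} => h.blockInv hv b i) = b.1 :=
    funext fun i => h.blockInv_of_mem hv b i.2
  rw [this, h.blockInv_of_notMem hv b hj, norm_smul, Circle.norm_coe, mul_one, Real.norm_eq_abs,
    sq_abs, Real.sq_sqrt (hb j hj).le]

/-- The block coordinates at a vertex. -/
noncomputable def blockChart : OpenPartialHomeomorph P.momentAngle (P.Block v) :=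
  have key : ∀ b : P.Block v, (∀ j, v ∉ P.facet j → 0 < h.sqRadius hv j b.1) →
      h.embedding (Function.invFun h.embedding (h.blockInv hv b)) = h.blockInv hv b :=
    fun _ hb => Function.invFun_eq (h.blockInv_mem_range hv hb)
  have hsq : ∀ (p : P.momentAngle) j, v ∉ P.facet j →
      h.sqRadius hv j (fun i => h.embedding p i) = ‖h.embedding p j‖ ^ 2 := fun p =>
    (h.mem_range_embedding_iff_sqRadius hv).1 ⟨p, rfl⟩
  { toFun := fun p => (fun i => h.embedding p i, fun j => unitPhase (h.embedding p j))
    invFun := fun b => Function.invFun h.embedding (h.blockInv hv b)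
    -- Nonvanishing of coordinate `j` means that `x` is off the facet `j`, so this is `U_v`.
    source := {p | ∀ j, v ∉ P.facet j → h.embedding p j ≠ 0}
    target := {b | ∀ j, v ∉ P.facet j → 0 < h.sqRadius hv j b.1}
    map_source' := fun p hp j hj => by
      rw [hsq p j hj]
      have := norm_pos_iff.2 (hp j hj)
      positivity
    map_target' := fun b hb j hj => by
      rw [key b hb, h.blockInv_of_notMem hv b hj]
      exact smul_ne_zero (Real.sqrt_pos.2 (hb j hj)).ne' (Circle.coe_ne_zero _)
    left_inv' := fun p hp => by
      convert Function.leftInverse_invFun h.embedding_injective p using 2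
      funext j
      by_cases hj : v ∈ P.facet j
      · rw [h.blockInv_of_mem hv _ hj]
      · rw [h.blockInv_of_notMem hv _ hj, hsq p j hj, Real.sqrt_sq (norm_nonneg _),
          Complex.real_smul, norm_mul_unitPhase]
    right_inv' := fun b hb => by
      rw [key b hb]
      refine Prod.ext (funext fun i => h.blockInv_of_mem hv b i.2) (funext fun j => ?_)
      simp only
      rw [h.blockInv_of_notMem hv b j.2, Complex.real_smul, mul_comm,
        unitPhase_mul_ofReal _ (Real.sqrt_pos.2 (hb j j.2))]
    open_source := by
      simp only [Set.ofPred_forall]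
      exact isOpen_iInter_of_finite fun j => isOpen_iInter_of_finite fun _ =>
        isOpen_ne_fun ((continuous_apply j).comp h.continuous_embedding) continuous_const
    open_target := by
      simp only [Set.ofPred_forall]
      exact isOpen_iInter_of_finite fun j => isOpen_iInter_of_finite fun _ =>
        isOpen_lt continuous_const ((h.contDiff_sqRadius hv j).continuous.comp continuous_fst)
    continuousOn_toFun := by
      have hc : ∀ j, Continuous fun p => h.embedding p j := fun j =>
        (continuous_apply j).comp h.continuous_embedding
      refine ContinuousOn.prodMk (continuous_pi fun i : {i // v ∈ P.facet i} => hc i).continuousOn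
        (continuousOn_pi.2 fun j p hp => ?_)
      exact (ContinuousAt.comp (f := fun p => h.embedding p j)
        (contMDiffAt_unitPhase (hp j j.2)).continuousAt (hc j).continuousAt).continuousWithinAt
    continuousOn_invFun := by
      rw [h.isEmbedding_embedding.continuousOn_iff]
      refine ContinuousOn.congr (f := h.blockInv hv) ?_ key
      refine Continuous.continuousOn (continuous_pi fun j => ?_)
      by_cases hj : v ∈ P.facet j
      · simp only [h.blockInv_of_mem hv _ hj]
        fun_prop
      · simp only [h.blockInv_of_notMem hv _ hj]
        refine Continuous.smul (Real.continuous_sqrt.comp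
          ((h.contDiff_sqRadius hv j).continuous.comp continuous_fst)) ?_
        exact continuous_subtype_val.comp ((continuous_apply _).comp continuous_snd) }

theorem blockChart_apply (p : P.momentAngle) : h.blockChart hv p =
    (fun i : {i // v ∈ P.facet i} => h.embedding p i,
      fun j : {j // v ∉ P.facet j} => unitPhase (h.embedding p j)) := rfl

theorem mem_blockChart_source {p : P.momentAngle} :
    p ∈ (h.blockChart hv).source ↔ ∀ j, v ∉ P.facet j → h.embedding p j ≠ 0 := Iff.rfl

theorem embedding_blockChart_symm {b : P.Block v} (hb : b ∈ (h.blockChart hv).target) :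
    h.embedding ((h.blockChart hv).symm b) = h.blockInv hv b :=
  Function.invFun_eq (h.blockInv_mem_range hv hb)

theorem mk_mem_blockChart_source {t : Fin m → Circle} {x : P.carrier} :
    P.toMomentAngle t x ∈ (h.blockChart hv).source ↔ P.facetsThrough x ⊆ P.facetsThrough v := by
  simp only [mem_blockChart_source, ne_eq, embedding_eq_zero_iff, not_imp_not]
  rfl

theorem isBlockChart_blockChart : P.IsBlockChart ℓ v (h.blockChart hv) := by
  refine ⟨Set.ext fun z => ?_, fun t x hx => ?_⟩
  · obtain ⟨t, x, rfl⟩ := exists_toMomentAngle_eq z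
    rw [mk_mem_blockChart_source]
    refine ⟨fun hx => ⟨t, x, hx, rfl⟩, ?_⟩
    rintro ⟨s, y, hy, hz⟩
    rwa [← h.mk_mem_blockChart_source hv (t := t), hz, mk_mem_blockChart_source]
  · rw [blockChart_apply]
    refine Prod.ext rfl (funext fun j => ?_)
    exact unitPhase_mul_ofReal _ (Real.sqrt_pos.2 (h.pos x.2 fun hj => j.2 (hx hj)))

end Vertex

end IsDefiningSystem

end SimplePolytope

/-! ### Logarithmic charts that straighten the image, and the smooth structure. -/

namespace SimplePolytope

variable {n m : ℕ} {P : SimplePolytope n m}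
  {ℓ ℓ' : Fin m → (EuclideanSpace ℝ (Fin n) →ᵃ[ℝ] ℝ)}

namespace IsDefiningSystem

section Vertex

open Classical

variable (h : P.IsDefiningSystem ℓ) {v : EuclideanSpace ℝ (Fin n)}
  (hv : v ∈ P.carrier.extremePoints ℝ)

theorem _root_.div_sqrt_mem_slitPlane {z : ℂ} (hz : z ∈ Complex.slitPlane) {r : ℝ} (hr : 0 < r) :
    z / (Real.sqrt r : ℂ) ∈ Complex.slitPlane := by
  rw [Complex.mem_slitPlane_iff] at hz ⊢
  have := Real.sqrt_pos.2 hr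
  rw [Complex.div_ofReal_re, Complex.div_ofReal_im]
  exact hz.imp (fun h => div_pos h this) fun h => div_ne_zero h this.ne'

theorem _root_.Complex.exp_mem_slitPlane_of_im_mem {w : ℂ} (h1 : -Real.pi < w.im)
    (h2 : w.im < Real.pi) : Complex.exp w ∈ Complex.slitPlane := by
  rw [Complex.mem_slitPlane_iff_arg]
  refine ⟨?_, Complex.exp_ne_zero w⟩
  rw [← Complex.log_im, Complex.log_exp h1 h2.le]
  exact h2.ne

/-- Near a point over the vertex `v`, a chart of `ℂ^m` that straightens the image of `Z_P`. The
coordinates of the facets through `v` are kept; the others are replaced by logarithms, whose real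
parts vanish on the image. -/
noncomputable def logChart (u : Fin m → Circle) :
    OpenPartialHomeomorph (Fin m → ℂ) (Fin m → ℂ) :=
  let r : Fin m → (Fin m → ℂ) → ℝ := fun j z => h.sqRadius hv j fun i => z i
  -- Dividing by `u j` moves points of phase `u j` to the positive axis, away from the branch cut;
  -- dividing by the square root makes the modulus `1` on the image.
  let f : (Fin m → ℂ) → Fin m → ℂ := fun z j => if v ∈ P.facet j then z j
    else Complex.log (z j * (u j : ℂ)⁻¹ / Real.sqrt (r j z))
  let g : (Fin m → ℂ) → Fin m → ℂ := fun w j => if v ∈ P.facet j then w j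
    else u j * (Real.sqrt (r j w) * Complex.exp (w j))
  have hf1 : ∀ z j, v ∈ P.facet j → f z j = z j := fun z j hj => if_pos hj
  have hf2 : ∀ z j, v ∉ P.facet j → f z j =
    Complex.log (z j * (u j : ℂ)⁻¹ / Real.sqrt (r j z)) := fun z j hj => if_neg hj
  have hg1 : ∀ w j, v ∈ P.facet j → g w j = w j := fun z j hj => if_pos hj
  have hg2 : ∀ w j, v ∉ P.facet j → g w j =
    u j * (Real.sqrt (r j w) * Complex.exp (w j)) := fun z j hj => if_neg hj
  -- The radii depend only on the coordinates that `f` and `g` keep, so neither map changes them.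
  have hrf : ∀ j z, r j (f z) = r j z := fun j z =>
    congrArg (h.sqRadius hv j) (funext fun i => hf1 z i i.2)
  have hrg : ∀ j z, r j (g z) = r j z := fun j z =>
    congrArg (h.sqRadius hv j) (funext fun i => hg1 z i i.2)
  have hrc : ∀ j, Continuous (r j) := fun j =>
    (h.contDiff_sqRadius hv j).continuous.comp (by fun_prop)
  { toFun := f
    invFun := g
    source := {z | ∀ j, v ∉ P.facet j → 0 < r j z ∧ z j * (u j : ℂ)⁻¹ ∈ Complex.slitPlane}
    target := {w | ∀ j, v ∉ P.facet j → 0 < r j w ∧ -Real.pi < (w j).im ∧ (w j).im < Real.pi}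
    map_source' := fun z hz j hj => by
      obtain ⟨h1, h2⟩ := hz j hj
      have h3 := div_sqrt_mem_slitPlane h2 h1
      rw [hrf, hf2 z j hj, Complex.log_im]
      exact ⟨h1, Complex.neg_pi_lt_arg _,
        (Complex.arg_le_pi _).lt_of_ne (Complex.mem_slitPlane_iff_arg.1 h3).1⟩
    map_target' := fun w hw j hj => by
      obtain ⟨h1, h2, h3⟩ := hw j hj
      have h4 := Complex.exp_mem_slitPlane_of_im_mem h2 h3
      have h5 := Real.sqrt_pos.2 h1
      have h6 : (u j : ℂ) * (Real.sqrt (r j w) * Complex.exp (w j)) * (u j : ℂ)⁻¹ =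
        Real.sqrt (r j w) * Complex.exp (w j) := by
        field_simp [Circle.coe_ne_zero (u j)]
      rw [hrg, hg2 w j hj, h6, Complex.mem_slitPlane_iff, Complex.re_ofReal_mul,
        Complex.im_ofReal_mul]
      exact ⟨h1, (Complex.mem_slitPlane_iff.1 h4).imp (mul_pos h5) (mul_ne_zero h5.ne')⟩
    left_inv' := fun z hz => funext fun j => by
      by_cases hj : v ∈ P.facet j
      · rw [hg1 _ j hj, hf1 z j hj]
      · obtain ⟨h1, h2⟩ := hz j hj
        rw [hg2 _ j hj, hf2 z j hj, hrf,
          Complex.exp_log (Complex.slitPlane_ne_zero (div_sqrt_mem_slitPlane h2 h1))]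
        have h5 : (Real.sqrt (r j z) : ℂ) ≠ 0 := by exact_mod_cast (Real.sqrt_pos.2 h1).ne'
        field_simp [Circle.coe_ne_zero (u j)]
    right_inv' := fun w hw => funext fun j => by
      by_cases hj : v ∈ P.facet j
      · rw [hf1 _ j hj, hg1 w j hj]
      · obtain ⟨h1, h2, h3⟩ := hw j hj
        have h5 : (Real.sqrt (r j w) : ℂ) ≠ 0 := by exact_mod_cast (Real.sqrt_pos.2 h1).ne'
        have h6 : (u j : ℂ) * (Real.sqrt (r j w) * Complex.exp (w j)) * (u j : ℂ)⁻¹ /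
          Real.sqrt (r j w) = Complex.exp (w j) := by
          field_simp [Circle.coe_ne_zero (u j)]
        rw [hf2 _ j hj, hg2 w j hj, hrg, h6, Complex.log_exp h2 h3.le]
    open_source := by
      simp only [Set.ofPred_forall]
      refine isOpen_iInter_of_finite fun j => isOpen_iInter_of_finite fun _ => ?_
      have hc : Continuous fun z : Fin m → ℂ => z j * (u j : ℂ)⁻¹ :=
        (continuous_apply j).mul continuous_const
      exact (isOpen_lt continuous_const (hrc j)).inter (Complex.isOpen_slitPlane.preimage hc)
    open_target := by
      simp only [Set.ofPred_forall]
      refine isOpen_iInter_of_finite fun j => isOpen_iInter_of_finite fun _ => ?_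
      have hc : Continuous fun w : Fin m → ℂ => (w j).im :=
        Complex.continuous_im.comp (continuous_apply j)
      exact (isOpen_lt continuous_const (hrc j)).inter
        ((isOpen_lt continuous_const hc).inter (isOpen_lt hc continuous_const))
    continuousOn_toFun := by
      refine continuousOn_pi.2 fun j => ?_
      by_cases hj : v ∈ P.facet j
      · simp only [hf1 _ j hj]
        fun_prop
      · simp only [hf2 _ j hj]
        refine ContinuousOn.clog (ContinuousOn.div (by fun_prop)
          (Complex.continuous_ofReal.comp (Real.continuous_sqrt.comp (hrc j))).continuousOn ?_) ?_
        · intro z hz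
          exact_mod_cast (Real.sqrt_pos.2 (hz j hj).1).ne'
        · exact fun z hz => div_sqrt_mem_slitPlane (hz j hj).2 (hz j hj).1
    continuousOn_invFun := by
      refine Continuous.continuousOn (continuous_pi fun j => ?_)
      by_cases hj : v ∈ P.facet j
      · simp only [hg1 _ j hj]
        fun_prop
      · simp only [hg2 _ j hj]
        exact continuous_const.mul ((Complex.continuous_ofReal.comp
          (Real.continuous_sqrt.comp (hrc j))).mul (by fun_prop)) }

theorem mem_logChart_source {u : Fin m → Circle} {z : Fin m → ℂ} :
    z ∈ (h.logChart hv u).source ↔ ∀ j, v ∉ P.facet j →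
      0 < h.sqRadius hv j (fun i => z i) ∧ z j * (u j : ℂ)⁻¹ ∈ Complex.slitPlane := Iff.rfl

theorem logChart_apply {u : Fin m → Circle} (z : Fin m → ℂ) (j : Fin m) :
    h.logChart hv u z j = if v ∈ P.facet j then z j else
      Complex.log (z j * (u j : ℂ)⁻¹ / Real.sqrt (h.sqRadius hv j fun i => z i)) := rfl

theorem logChart_symm_apply {u : Fin m → Circle} (w : Fin m → ℂ) (j : Fin m) :
    (h.logChart hv u).symm w j = if v ∈ P.facet j then w j else
      u j * (Real.sqrt (h.sqRadius hv j fun i => w i) * Complex.exp (w j)) := rfl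

theorem contDiff_sqRadius_restrict (j : Fin m) :
    ContDiff ℝ ∞ fun z : Fin m → ℂ => h.sqRadius hv j fun i => z i :=
  (h.contDiff_sqRadius hv j).comp (contDiff_pi.2 fun i => contDiff_apply ℝ ℂ i.1)

theorem contDiffOn_logChart (u : Fin m → Circle) :
    ContDiffOn ℝ ∞ (h.logChart hv u) (h.logChart hv u).source := by
  refine contDiffOn_pi.2 fun j => ?_
  simp only [logChart_apply]
  by_cases hj : v ∈ P.facet j
  · simp only [if_pos hj]
    exact (contDiff_apply ℝ ℂ j).contDiffOn
  · simp only [if_neg hj]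
    intro z hz
    obtain ⟨h1, h2⟩ := hz j hj
    have hs : ContDiffAt ℝ ∞ (fun z : Fin m → ℂ =>
        (Real.sqrt (h.sqRadius hv j fun i => z i) : ℂ)) z :=
      Complex.ofRealCLM.contDiff.contDiffAt.comp z
        ((h.contDiff_sqRadius_restrict hv j).contDiffAt.sqrt h1.ne')
    have hn : ContDiffAt ℝ ∞ (fun z : Fin m → ℂ => z j * (u j : ℂ)⁻¹) z :=
      (contDiff_apply ℝ ℂ j).contDiffAt.mul contDiffAt_const
    have hd : ContDiffAt ℝ ∞ (fun z : Fin m → ℂ =>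
        z j * (u j : ℂ)⁻¹ / (Real.sqrt (h.sqRadius hv j fun i => z i) : ℂ)) z := by
      simp only [div_eq_mul_inv]
      exact hn.mul (hs.inv (by exact_mod_cast (Real.sqrt_pos.2 h1).ne'))
    have hl := (Complex.contDiffAt_log (n := ∞) (div_sqrt_mem_slitPlane h2 h1)).restrict_scalars ℝ
    exact (ContDiffAt.comp (f := fun z : Fin m → ℂ =>
      z j * (u j : ℂ)⁻¹ / (Real.sqrt (h.sqRadius hv j fun i => z i) : ℂ)) z hl hd).contDiffWithinAt

theorem contDiffOn_logChart_symm (u : Fin m → Circle) :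
    ContDiffOn ℝ ∞ (h.logChart hv u).symm (h.logChart hv u).target := by
  refine contDiffOn_pi.2 fun j => ?_
  simp only [logChart_symm_apply]
  by_cases hj : v ∈ P.facet j
  · simp only [if_pos hj]
    exact (contDiff_apply ℝ ℂ j).contDiffOn
  · simp only [if_neg hj]
    intro w hw
    have hs : ContDiffAt ℝ ∞ (fun z : Fin m → ℂ =>
        (Real.sqrt (h.sqRadius hv j fun i => z i) : ℂ)) w :=
      Complex.ofRealCLM.contDiff.contDiffAt.comp w
        ((h.contDiff_sqRadius_restrict hv j).contDiffAt.sqrt (hw j hj).1.ne')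
    have he : ContDiffAt ℝ ∞ (fun z : Fin m → ℂ => Complex.exp (z j)) w :=
      (Complex.contDiff_exp.comp (contDiff_apply ℝ ℂ j)).contDiffAt
    exact (contDiffAt_const.mul (hs.mul he)).contDiffWithinAt

/-- The real part of the logarithm is `log (‖z j‖ / √r)` with `r` the value of `sqRadius`; it
vanishes exactly when `‖z j‖ ^ 2 = r`. -/
theorem mem_range_embedding_iff_logChart {u : Fin m → Circle} {z : Fin m → ℂ}
    (hz : z ∈ (h.logChart hv u).source) :
    z ∈ Set.range h.embedding ↔ ∀ j, v ∉ P.facet j → (h.logChart hv u z j).re = 0 := by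
  rw [h.mem_range_embedding_iff_sqRadius hv]
  refine forall₂_congr fun j hj => ?_
  obtain ⟨h1, h2⟩ := (h.mem_logChart_source hv).1 hz j hj
  have h3 := Real.sqrt_pos.2 h1
  have h4 : z j ≠ 0 := left_ne_zero_of_mul (Complex.slitPlane_ne_zero h2)
  have h5 : 0 < ‖z j‖ := norm_pos_iff.2 h4
  rw [logChart_apply, if_neg hj, Complex.log_re, norm_div, norm_mul, norm_inv, Circle.norm_coe,
    inv_one, mul_one, Complex.norm_of_nonneg h3.le, Real.log_div h5.ne' h3.ne', sub_eq_zero,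
    Real.log_injOn_pos.eq_iff h5 h3, eq_comm (a := ‖z j‖),
    Real.sqrt_eq_iff_eq_sq h1.le h5.le]

theorem _root_.SimplePolytope.dim_le_of_vertex {v : EuclideanSpace ℝ (Fin n)}
    (hv : v ∈ P.carrier.extremePoints ℝ) : n ≤ m := by
  rw [← card_facets_vertex hv]
  exact (Fintype.card_subtype_le _).trans_eq (Fintype.card_fin m)

theorem exists_equiv_re_eq_zero {v : EuclideanSpace ℝ (Fin n)}
    (hv : v ∈ P.carrier.extremePoints ℝ) :
    ∃ e : (EuclideanSpace ℝ (Fin (m + n)) × EuclideanSpace ℝ (Fin (m - n))) ≃L[ℝ] (Fin m → ℂ),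
      ∀ w, (e.symm w).2 = 0 ↔ ∀ j, v ∉ P.facet j → (w j).re = 0 := by
  let R : (Fin m → ℂ) →ₗ[ℝ] ({j // v ∉ P.facet j} → ℝ) :=
    LinearMap.pi fun j => Complex.reLm.comp (LinearMap.proj j.1)
  have hR : Function.Surjective R := fun y =>
    ⟨fun j => if hj : v ∉ P.facet j then (y ⟨j, hj⟩ : ℂ) else 0, by
      funext j
      simp [R, j.2]⟩
  have hnm : n ≤ m := dim_le_of_vertex hv
  have hc : Fintype.card {j // v ∉ P.facet j} = m - n := by
    rw [Fintype.card_subtype_compl, card_facets_vertex hv, Fintype.card_fin]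
  obtain ⟨e, he⟩ := exists_equiv_prod_of_surjective
    (E := EuclideanSpace ℝ (Fin (m + n))) (F := EuclideanSpace ℝ (Fin (m - n))) R hR
    (by simp [hc]) (by simp [Module.finrank_pi_fintype, Complex.finrank_real_complex]; omega)
  refine ⟨e, fun w => (he w).trans ?_⟩
  simp [R, funext_iff]

end Vertex

theorem exists_chartedSpace (h : P.IsDefiningSystem ℓ) :
    ∃ _ : ChartedSpace (EuclideanSpace ℝ (Fin (m + n))) P.momentAngle,
      IsManifold (𝓡 (m + n)) ∞ P.momentAngle ∧
      Manifold.IsSmoothEmbedding (𝓡 (m + n)) 𝓘(ℝ, Fin m → ℂ) ∞ h.embedding := by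
  refine exists_chartedSpace_of_slices (F := EuclideanSpace ℝ (Fin (m - n)))
    h.isEmbedding_embedding fun p => ?_
  obtain ⟨t, x, rfl⟩ := exists_toMomentAngle_eq p
  obtain ⟨v, hv, hxv⟩ := P.exists_vertex x.2
  obtain ⟨e, he⟩ := exists_equiv_re_eq_zero hv
  -- With `u = t`, the coordinates of the point off `v` are rotated to positive reals.
  refine ⟨e, h.logChart hv t, fun j hj => ?_, h.contDiffOn_logChart hv t,
    h.contDiffOn_logChart_symm hv t, fun z hz => ?_⟩
  · have h1 := (h.mem_range_embedding_iff_sqRadius hv).1 ⟨P.toMomentAngle t x, rfl⟩ j hj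
    have h2 : 0 < ℓ j x := h.pos x.2 fun hx => hj (hxv hx)
    rw [h.sq_norm_embedding] at h1
    refine ⟨h2.trans_eq h1.symm, ?_⟩
    rw [embedding_mk, mul_right_comm, mul_inv_cancel₀ (Circle.coe_ne_zero _), one_mul]
    exact Complex.ofReal_mem_slitPlane.2 (Real.sqrt_pos.2 h2)
  · rw [h.mem_range_embedding_iff_logChart hv hz, he]

/-! ### Smoothness of the block coordinates and of their inverses. -/

section Smooth

open Classical

theorem contMDiffOn_blockInv (h : P.IsDefiningSystem ℓ) {v : EuclideanSpace ℝ (Fin n)}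
    (hv : v ∈ P.carrier.extremePoints ℝ) :
    ContMDiffOn
      (𝓘(ℝ, {i // v ∈ P.facet i} → ℂ).prod
        (ModelWithCorners.pi fun _ : {i // v ∉ P.facet i} => 𝓡 1)) 𝓘(ℝ, Fin m → ℂ) ∞
      (h.blockInv hv) (h.blockChart hv).target := by
  refine contMDiffOn_pi_space.2 fun j => ?_
  by_cases hj : v ∈ P.facet j
  · simp only [h.blockInv_of_mem hv _ hj]
    exact ((contDiff_apply ℝ ℂ _).contMDiff.comp contMDiff_fst).contMDiffOn
  · simp only [h.blockInv_of_notMem hv _ hj]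
    intro b hb
    refine ContMDiffAt.contMDiffWithinAt ?_
    have h1 : ContMDiffAt
        (𝓘(ℝ, {i // v ∈ P.facet i} → ℂ).prod
          (ModelWithCorners.pi fun _ : {i // v ∉ P.facet i} => 𝓡 1)) 𝓘(ℝ, ℝ) ∞
        -- The square root is smooth here because the target of the chart requires a positive
        -- radius.
        (fun b : P.Block v => Real.sqrt (h.sqRadius hv j b.1)) b :=
      ContMDiffAt.comp (g := fun z => Real.sqrt (h.sqRadius hv j z)) b
        (((h.contDiff_sqRadius hv j).contDiffAt.sqrt (hb j hj).ne').contMDiffAt) contMDiffAt_fst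
    have h2 : ContMDiffAt
        (𝓘(ℝ, {i // v ∈ P.facet i} → ℂ).prod
          (ModelWithCorners.pi fun _ : {i // v ∉ P.facet i} => 𝓡 1)) 𝓘(ℝ, ℂ) ∞
        (fun b : P.Block v => (b.2 ⟨j, hj⟩ : ℂ)) b :=
      (contMDiff_circle_coe.comp
        ((contMDiff_pi_eval (⟨j, hj⟩ : {j // v ∉ P.facet j})).comp contMDiff_snd)).contMDiffAt
    exact h1.smul h2

variable [ChartedSpace (EuclideanSpace ℝ (Fin (m + n))) P.momentAngle]

theorem contMDiffOn_blockChart (h : P.IsDefiningSystem ℓ) {v : EuclideanSpace ℝ (Fin n)}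
    (hv : v ∈ P.carrier.extremePoints ℝ)
    (hs : ContMDiff (𝓡 (m + n)) 𝓘(ℝ, Fin m → ℂ) ∞ h.embedding) :
    ContMDiffOn (𝓡 (m + n))
      (𝓘(ℝ, {i // v ∈ P.facet i} → ℂ).prod
        (ModelWithCorners.pi fun _ : {i // v ∉ P.facet i} => 𝓡 1)) ∞
      (h.blockChart hv) (h.blockChart hv).source := by
  intro p hp
  have hc : ∀ j, ContMDiffAt (𝓡 (m + n)) 𝓘(ℝ, ℂ) ∞ (fun p => h.embedding p j) p := fun j =>
    contMDiffAt_pi_space.1 hs.contMDiffAt j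
  refine ContMDiffWithinAt.prodMk (f := fun p (i : {i // v ∈ P.facet i}) => h.embedding p i)
    (g := fun p (j : {j // v ∉ P.facet j}) => unitPhase (h.embedding p j))
    (contMDiffWithinAt_pi_space.2 fun i => (hc i).contMDiffWithinAt)
    (contMDiffWithinAt_pi_of_forall fun j => ?_)
  exact ((contMDiffAt_unitPhase (hp j j.2)).comp p (hc j)).contMDiffWithinAt

end Smooth

end IsDefiningSystem

end SimplePolytope

/-! ### Smoothness of maps that match two charts. -/

section ChartTransfer

variable {E E' EB H H' HB M M' B : Type*} [NormedAddCommGroup E] [NormedSpace ℝ E]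
  [NormedAddCommGroup E'] [NormedSpace ℝ E'] [NormedAddCommGroup EB] [NormedSpace ℝ EB]
  [TopologicalSpace H] [TopologicalSpace H'] [TopologicalSpace HB] {I : ModelWithCorners ℝ E H}
  {I' : ModelWithCorners ℝ E' H'} {J : ModelWithCorners ℝ EB HB} [TopologicalSpace M]
  [TopologicalSpace M'] [TopologicalSpace B] {k : ℕ∞ω}

theorem contMDiffAt_of_charts [c : ChartedSpace H M] [c' : ChartedSpace H' M']
    [ChartedSpace HB B] {φ : OpenPartialHomeomorph M B} {φ' : OpenPartialHomeomorph M' B}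
    (hφ : ContMDiffOn I J k φ φ.source) (hφ' : ContMDiffOn J I' k φ'.symm φ'.target) {f : M → M'}
    (hf : ∀ q ∈ φ.source, f q ∈ φ'.source ∧ φ' (f q) = φ q) {p : M} (hp : p ∈ φ.source) :
    ContMDiffAt I I' k f p := by
  have ht : ∀ q ∈ φ.source, φ q ∈ φ'.target := fun q hq =>
    (hf q hq).2 ▸ φ'.map_source (hf q hq).1
  have h : ContMDiffOn I I' k (φ'.symm ∘ φ) φ.source := hφ'.comp hφ ht
  refine (h.contMDiffAt (φ.open_source.mem_nhds hp)).congr_of_eventuallyEq ?_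
  filter_upwards [φ.open_source.mem_nhds hp] with q hq
  rw [Function.comp_apply, ← (hf q hq).2, φ'.left_inv (hf q hq).1]

end ChartTransfer

/-! ### The canonical structure, its uniqueness and the action. -/

namespace SimplePolytope

variable {n m : ℕ} {P : SimplePolytope n m}
  {ℓ ℓ' : Fin m → (EuclideanSpace ℝ (Fin n) →ᵃ[ℝ] ℝ)}

/-- Embeddings of different systems differ by constant factors in each coordinate, so a structure
built from one `ℓ` serves them all. -/
theorem IsDefiningSystem.contMDiffAt_embedding_of_embedding (h : P.IsDefiningSystem ℓ)
    (h' : P.IsDefiningSystem ℓ') {E H N : Type*} [NormedAddCommGroup E] [NormedSpace ℝ E]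
    [TopologicalSpace H] {I : ModelWithCorners ℝ E H} [TopologicalSpace N] [ChartedSpace H N]
    {f : N → P.momentAngle} {x : N}
    (hs : ContMDiffAt I 𝓘(ℝ, Fin m → ℂ) ∞ (fun y => h.embedding (f y)) x) :
    ContMDiffAt I 𝓘(ℝ, Fin m → ℂ) ∞ (fun y => h'.embedding (f y)) x := by
  obtain ⟨c, hc⟩ := h.exists_embedding_eq_mul h'
  simp only [hc]
  refine contMDiffAt_pi_space.2 fun j => ?_
  have h1 : ContMDiffAt I 𝓘(ℝ, ℝ) ∞ (fun _ : N => c j) x := contMDiffAt_const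
  exact h1.smul (contMDiffAt_pi_space.1 hs j)

theorem IsDefiningSystem.isCanonicalSmoothStructure (h : P.IsDefiningSystem ℓ)
    [cs : ChartedSpace (EuclideanSpace ℝ (Fin (m + n))) P.momentAngle]
    [hman : IsManifold (𝓡 (m + n)) ∞ P.momentAngle]
    (hemb : Manifold.IsSmoothEmbedding (𝓡 (m + n)) 𝓘(ℝ, Fin m → ℂ) ∞ h.embedding) :
    P.IsCanonicalSmoothStructure cs := by
  classical
  refine ⟨hman, fun ℓ' h' v hv => ⟨h'.blockChart hv, h'.isBlockChart_blockChart hv, ?_, ?_⟩⟩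
  · exact h'.contMDiffOn_blockChart hv fun p =>
      h.contMDiffAt_embedding_of_embedding h' hemb.contMDiff.contMDiffAt
  · intro b hb
    have hnhds := (h'.blockChart hv).open_target.mem_nhds hb
    -- A continuous map into `Z_P` is smooth once its composite with the immersion is; here that
    -- composite is `blockInv`, up to rescaling.
    refine ContMDiffAt.contMDiffWithinAt <|
      (ContMDiffAt.iff_comp_isImmersionAt (hemb.isImmersion.isImmersionAt _)).2
        ⟨(h'.blockChart hv).symm.continuousAt hb, ?_⟩
    refine h'.contMDiffAt_embedding_of_embedding h ?_
    refine ((h'.contMDiffOn_blockInv hv).contMDiffAt hnhds).congr_of_eventuallyEq ?_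
    filter_upwards [hnhds] with b' hb'
    exact h'.embedding_blockChart_symm hv hb'

/-- `IsBlockChart` fixes the source of the chart and its values there, so the block charts of both
structures at one vertex agree and the identity is `φ'.symm ∘ φ` locally. -/
theorem IsCanonicalSmoothStructure.contMDiff_id
    {cs cs' : ChartedSpace (EuclideanSpace ℝ (Fin (m + n))) P.momentAngle}
    (hcs : P.IsCanonicalSmoothStructure cs) (hcs' : P.IsCanonicalSmoothStructure cs') :
    @ContMDiff ℝ _ _ _ _ _ _ (𝓡 (m + n)) P.momentAngle _ cs _ _ _ _ _ (𝓡 (m + n))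
      P.momentAngle _ cs' ∞ id := by
  classical
  intro p
  obtain ⟨t, x, rfl⟩ := exists_toMomentAngle_eq p
  obtain ⟨ℓ, hℓ⟩ := P.exists_halfspaces
  obtain ⟨v, hv, hxv⟩ := P.exists_vertex x.2
  obtain ⟨φ, hφ, hφs, -⟩ := hcs.2 ℓ hℓ v hv
  obtain ⟨φ', hφ', -, hφs'⟩ := hcs'.2 ℓ hℓ v hv
  refine contMDiffAt_of_charts (c := cs) (c' := cs') hφs hφs' (fun q hq => ?_)
    (hφ.1 ▸ ⟨t, x, hxv, rfl⟩)
  refine ⟨by rw [hφ'.1, ← hφ.1]; exact hq, ?_⟩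
  rw [hφ.1] at hq
  obtain ⟨s, y, hy, rfl⟩ := hq
  exact (hφ'.2 s y hy).trans (hφ.2 s y hy).symm

theorem IsDefiningSystem.contMDiff_smul (h : P.IsDefiningSystem ℓ)
    [ChartedSpace (EuclideanSpace ℝ (Fin (m + n))) P.momentAngle]
    (hemb : Manifold.IsSmoothEmbedding (𝓡 (m + n)) 𝓘(ℝ, Fin m → ℂ) ∞ h.embedding) :
    ContMDiff ((ModelWithCorners.pi fun _ : Fin m => 𝓡 1).prod (𝓡 (m + n))) (𝓡 (m + n)) ∞
      (fun p : (Fin m → Circle) × P.momentAngle => p.1 • p.2) := by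
  have hs : ContMDiff ((ModelWithCorners.pi fun _ : Fin m => 𝓡 1).prod (𝓡 (m + n)))
      𝓘(ℝ, Fin m → ℂ) ∞
      (fun p : (Fin m → Circle) × P.momentAngle => h.embedding (p.1 • p.2)) := by
    refine contMDiff_pi_space.2 fun j => ?_
    simp only [h.embedding_smul]
    have h1 : ContMDiff ((ModelWithCorners.pi fun _ : Fin m => 𝓡 1).prod (𝓡 (m + n))) 𝓘(ℝ, ℂ) ∞
        (fun p : (Fin m → Circle) × P.momentAngle => (p.1 j : ℂ)) :=
      contMDiff_circle_coe.comp ((contMDiff_pi_eval j).comp contMDiff_fst)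
    have h2 : ContMDiff ((ModelWithCorners.pi fun _ : Fin m => 𝓡 1).prod (𝓡 (m + n))) 𝓘(ℝ, ℂ) ∞
        (fun p : (Fin m → Circle) × P.momentAngle => h.embedding p.2 j) :=
      (contMDiff_pi_space.1 hemb.contMDiff j).comp contMDiff_snd
    exact (contDiff_mul (𝕜 := ℝ) (𝔸 := ℂ) (n := ∞)).contMDiff.comp (h1.prodMk_space h2)
  -- Coordinatewise multiplication in `ℂ^m` is smooth, and smoothness descends through the
  -- immersion.
  exact (ContMDiff.iff_comp_isImmersion hemb.isImmersion).2
    ⟨h.isEmbedding_embedding.continuous_iff.2 hs.continuous, hs⟩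

end SimplePolytope

theorem mainTheorem4 (n m : ℕ) (P : SimplePolytope n m) :
    T2Space P.momentAngle ∧ SecondCountableTopology P.momentAngle ∧
    ∃ cs : ChartedSpace (EuclideanSpace ℝ (Fin (m + n))) P.momentAngle,
      P.IsCanonicalSmoothStructure cs ∧
      (∀ cs' : ChartedSpace (EuclideanSpace ℝ (Fin (m + n))) P.momentAngle,
        P.IsCanonicalSmoothStructure cs' →
          @IsManifold.maximalAtlas ℝ _ _ _ _ _ _ (𝓡 (m + n)) ∞ P.momentAngle _ cs' =
            @IsManifold.maximalAtlas ℝ _ _ _ _ _ _ (𝓡 (m + n)) ∞ P.momentAngle _ cs) ∧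
      ContMDiff ((ModelWithCorners.pi fun _ : Fin m => 𝓡 1).prod (𝓡 (m + n))) (𝓡 (m + n)) ∞
        (fun p : (Fin m → Circle) × P.momentAngle => p.1 • p.2) ∧
      ∃ i_e : P.momentAngle → (Fin m → ℂ),
        Manifold.IsSmoothEmbedding (𝓡 (m + n)) 𝓘(ℝ, Fin m → ℂ) ∞ i_e ∧
        (∀ z j, ‖i_e z j‖ ≤ 1) ∧
        (∀ (t : Fin m → Circle) (z : P.momentAngle) (j : Fin m),
          i_e (t • z) j = (t j : ℂ) * i_e z j) := by
  obtain ⟨ℓ, h, hle⟩ := P.exists_isDefiningSystem_le_one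
  obtain ⟨cs, hman, hemb⟩ := h.exists_chartedSpace
  have hcan := h.isCanonicalSmoothStructure hemb
  refine ⟨h.isEmbedding_embedding.t2Space, h.isEmbedding_embedding.secondCountableTopology,
    cs, hcan, fun cs' hcan' => ?_, h.contMDiff_smul hemb,
    h.embedding, hemb, fun z j => ?_, h.embedding_smul⟩
  · exact Set.Subset.antisymm
      (maximalAtlas_subset_of_contMDiff_id cs' cs hcan'.1 hman (hcan'.contMDiff_id hcan)
        (hcan.contMDiff_id hcan'))
      (maximalAtlas_subset_of_contMDiff_id cs cs' hman hcan'.1 (hcan.contMDiff_id hcan')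
        (hcan'.contMDiff_id hcan))
  · obtain ⟨t, x, rfl⟩ := SimplePolytope.exists_toMomentAngle_eq z
    rw [h.norm_embedding]
    exact Real.sqrt_le_one.2 (hle x x.2 j)
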